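/- Let $F_0=0$, $F_1=1$, $F_i=F_{i-1}+F_{i-2}$ for $i\ge 2$. The canonical Fibonacci representation $(n)_F$ of $n\in\mathbb N$ is the unique binary word $e_1e_2\cdots e_m$ with no leading zero and no two consecutive $1$'s such that $n=\sum_{i=1}^m e_iF_{m+2-i}$ (so $(0)_F=\varepsilon$). An infinite word $(a_n)_{n\ge 0}$ over an alphabet $\Delta$ is Fibonacci-automatic if there is a deterministic finite automaton with output, with finite state set $Q$, initial state $q_0$, transition function $\delta:Q\times\{0,1\}\to Q$ and output map $\kappa:Q\to\Delta$, such that $a_n=\kappa(\delta(q_0,(n)_F))$ for all $n\ge 0$, where $\delta$ is extended to words as usual. Let $\mathbf f=01001010\cdots$ be the infinite Fibonacci word, the fixed point of the morphism $0\mapsto 01$, $1\mapsto 0$. **Corollary.** Let $h:\{0,1\}^*\to\Delta^*$ be an arbitrary morphism such that $h(01)\neq\varepsilon$. Then $h(\mathbf f)$ is an infinite word (that is, the lengths of the images under $h$ of the prefixes of $\mathbf f$ are unbounded), and it is Fibonacci-automatic. -/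

import Mathlib

/-- The prefix `w[0..n-1]` of length `n` of an infinite word `w`. -/
def wordPrefix {α : Type*} (w : ℕ → α) (n : ℕ) : FreeMonoid α :=
  FreeMonoid.ofList ((List.range n).map w)

/-- The image `h(w)` of the infinite word `w` under the morphism `h` is infinite and equal to the
infinite word `u`: the images of the prefixes of `w` are prefixes of `u`, and their lengths are
unbounded. (So `u` is uniquely determined by `h` and `w`.) -/
structure IsInfiniteImage {α β : Type*} (h : FreeMonoid α →* FreeMonoid β)
    (w : ℕ → α) (u : ℕ → β) : Prop where
  image_prefix : ∀ n : ℕ, h (wordPrefix w n) = wordPrefix u (h (wordPrefix w n)).length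
  unbounded : ∀ N : ℕ, ∃ n : ℕ, N ≤ (h (wordPrefix w n)).length

/-- The Fibonacci morphism `0 ↦ 01`, `1 ↦ 0`. -/
def fibMorphism : FreeMonoid (Fin 2) →* FreeMonoid (Fin 2) :=
  FreeMonoid.lift ![FreeMonoid.of 0 * FreeMonoid.of 1, FreeMonoid.of 0]

theorem length_le_fibMorphism (x : FreeMonoid (Fin 2)) : x.length ≤ (fibMorphism x).length := by
  induction x using FreeMonoid.inductionOn' with
  | one => simp
  | of_mul a x ih =>
    rw [map_mul, FreeMonoid.length_mul, FreeMonoid.length_mul]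
    refine Nat.add_le_add ?_ ih
    fin_cases a <;> simp [fibMorphism]

theorem fibMorphism_iterate_eq (n : ℕ) :
    ∃ x : FreeMonoid (Fin 2), fibMorphism^[n] (FreeMonoid.of 0) = FreeMonoid.of 0 * x ∧
      n ≤ x.length := by
  induction n with
  | zero => exact ⟨1, by simp, by simp⟩
  | succ n ih =>
    obtain ⟨x, hx, hn⟩ := ih
    refine ⟨FreeMonoid.of 1 * fibMorphism x, ?_, ?_⟩
    · rw [Function.iterate_succ_apply', hx, map_mul, ← mul_assoc]
      simp [fibMorphism]
    · have := length_le_fibMorphism x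
      rw [FreeMonoid.length_mul, FreeMonoid.length_of]
      omega

theorem lt_length_fibMorphism_iterate (n : ℕ) :
    n < (FreeMonoid.toList (fibMorphism^[n] (FreeMonoid.of 0))).length := by
  obtain ⟨x, hx, hn⟩ := fibMorphism_iterate_eq n
  have h : (fibMorphism^[n] (FreeMonoid.of 0)).length = 1 + x.length := by
    rw [hx, FreeMonoid.length_mul, FreeMonoid.length_of]
  change n < (fibMorphism^[n] (FreeMonoid.of 0)).length
  omega

/-- The infinite Fibonacci word `f = 01001010⋯`, the fixed point of the Fibonacci morphism `φ`,
i.e. the limit of the words `φⁿ(0)`. Each of these is a prefix of the next one, and `φⁿ(0)` has more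
than `n` letters, so that `f[n]` is the letter of `φⁿ(0)` at position `n` (counted from `0`). -/
def fibWord (n : ℕ) : Fin 2 :=
  (FreeMonoid.toList (fibMorphism^[n] (FreeMonoid.of 0)))[n]'(lt_length_fibMorphism_iterate n)

/-- The canonical Fibonacci representation `(n)_F`, most significant digit first: the digits that
belong to the Fibonacci numbers `F_g, …, F_3, F_2`, where `F_g` is the greatest Fibonacci number
`≤ n`; the digit of `F_i` is `1` if and only if `F_i` occurs in the Zeckendorf representation
of `n`. It has no leading zero and no two consecutive ones; for `n = 0` it is the empty word. -/
def fibRep (n : ℕ) : List (Fin 2) :=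
  (List.range (n.greatestFib - 1)).reverse.map fun i => if i + 2 ∈ n.zeckendorf then 1 else 0

/-- A deterministic finite automaton with output: input alphabet `α`, output alphabet `Δ`. -/
structure DFAO (α Δ : Type*) where
  State : Type
  finite_state : Finite State
  start : State
  step : State → α → State
  output : State → Δ

/-- The output of the last state that is reached on the input word `x`. -/
def DFAO.eval {α Δ : Type*} (M : DFAO α Δ) (x : List α) : Δ :=
  M.output (x.foldl M.step M.start)

/-- The infinite word `a` is Fibonacci-automatic. -/
def IsFibonacciAutomatic {Δ : Type*} (a : ℕ → Δ) : Prop :=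
  ∃ M : DFAO (Fin 2) Δ, ∀ n : ℕ, a n = M.eval (fibRep n)

/-! Write φ for the Fibonacci morphism and V for the value of a digit word. Since φ fixes f, h may
be replaced by h ∘ φ², which erases no letter. With k = |y|, V(xy) = F_{k+1} V(x) + F_k (V(x0) -
V(x)) + V(y) (`fibValue_append`), and |h(φ^k(p))| obeys the same recurrence in k
(`length_iterate_fibMorphism`). Both V(x0)/V(x) and |h(φ(p))|/|h(p)| approximate the golden ratio
with bounded error, so each x has a prefix p of f with V(x) = |h(p)| + A and V(x0) = |h(φ(p))| + A +
B, where A, B are bounded (`exists_wordPrefix_near_fibValue`). Hence the letter of u at V(xy) sits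
in h(φ^k(w)) at offset F_{k+1} A + F_k B + V(y), where w is a factor of fixed length following p.
The finite datum (A, B, w) determines it for every y, and Myhill–Nerode (`exists_dfao_of_finite`)
yields the automaton. -/

/-! ### Prefixes of infinite words. -/

theorem eq_wordPrefix_iff {α : Type*} {w : ℕ → α} {x : FreeMonoid α} :
    x = wordPrefix w x.length ↔
      ∀ i < x.length, (FreeMonoid.toList x)[i]? = some (w i) := by
  constructor
  · intro hx i hi
    rw [hx]
    simp [wordPrefix, hi]
  · intro hx
    apply FreeMonoid.toList.injective
    apply List.ext_getElem?
    intro i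
    by_cases hi : i < x.length
    · rw [hx i hi]
      simp [wordPrefix, hi]
    · have h1 : (FreeMonoid.toList x).length ≤ i := not_lt.1 hi
      rw [List.getElem?_eq_none h1, List.getElem?_eq_none]
      simp only [wordPrefix, FreeMonoid.toList_ofList, List.length_map, List.length_range]
      exact h1

@[simp]
theorem length_wordPrefix {α : Type*} (w : ℕ → α) (n : ℕ) : (wordPrefix w n).length = n := by
  change (FreeMonoid.toList (wordPrefix w n)).length = n
  simp [wordPrefix]

theorem wordPrefix_succ {α : Type*} (w : ℕ → α) (n : ℕ) :
    wordPrefix w (n + 1) = wordPrefix w n * FreeMonoid.of (w n) := by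
  simp [wordPrefix, List.range_succ, FreeMonoid.ofList_append]

theorem wordPrefix_add {α : Type*} (w : ℕ → α) (m n : ℕ) :
    wordPrefix w (m + n) = wordPrefix w m * wordPrefix (fun i => w (m + i)) n := by
  induction n with
  | zero => simp [wordPrefix]
  | succ n ih => rw [← add_assoc, wordPrefix_succ, ih, wordPrefix_succ, mul_assoc]

theorem eq_wordPrefix_of_mul {α : Type*} {w : ℕ → α} {x y : FreeMonoid α}
    (h : x * y = wordPrefix w (x * y).length) : x = wordPrefix w x.length := by
  rw [eq_wordPrefix_iff] at h ⊢
  intro i hi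
  rw [← h i (by rw [FreeMonoid.length_mul]; omega), FreeMonoid.toList_mul,
    List.getElem?_append_left hi]

/-! ### Iterates of the Fibonacci morphism and images of f. -/

/-- On letters φ²(a) = φ(a)a, and lengths are additive. -/
theorem length_iterate_fibMorphism_add_two {β : Type*} (h : FreeMonoid (Fin 2) →* FreeMonoid β)
    (x : FreeMonoid (Fin 2)) :
    (h (fibMorphism (fibMorphism x))).length = (h (fibMorphism x)).length + (h x).length := by
  induction x using FreeMonoid.inductionOn' with
  | one => simp
  | of_mul a x ih =>
    simp only [map_mul, FreeMonoid.length_mul, ih]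
    fin_cases a <;> simp [fibMorphism, FreeMonoid.length_mul] <;> omega

theorem length_iterate_fibMorphism {β : Type*} (h : FreeMonoid (Fin 2) →* FreeMonoid β)
    (x : FreeMonoid (Fin 2)) (k : ℕ) :
    ((h (fibMorphism^[k] x)).length : ℤ) = Nat.fib (k + 1) * (h x).length +
      Nat.fib k * ((h (fibMorphism x)).length - (h x).length) := by
  induction k generalizing x with
  | zero => simp
  | succ k ih =>
    rw [Function.iterate_succ_apply, ih, length_iterate_fibMorphism_add_two,
      Nat.fib_add_two (n := k)]
    push_cast
    ring

theorem iterate_fibMorphism_mul (k : ℕ) (x y : FreeMonoid (Fin 2)) :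
    fibMorphism^[k] (x * y) = fibMorphism^[k] x * fibMorphism^[k] y := by
  induction k generalizing x y with
  | zero => rfl
  | succ k ih => simp only [Function.iterate_succ_apply, map_mul, ih]

theorem fibMorphism_iterate_prefix {m n : ℕ} (hmn : m ≤ n) :
    ∃ y, fibMorphism^[n] (FreeMonoid.of 0) = fibMorphism^[m] (FreeMonoid.of 0) * y := by
  obtain ⟨d, rfl⟩ := Nat.exists_eq_add_of_le hmn
  obtain ⟨x, hx, -⟩ := fibMorphism_iterate_eq d
  exact ⟨fibMorphism^[m] x, by rw [Function.iterate_add_apply, hx, iterate_fibMorphism_mul]⟩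

theorem fibMorphism_iterate_eq_wordPrefix (n : ℕ) :
    fibMorphism^[n] (FreeMonoid.of 0) =
      wordPrefix fibWord (fibMorphism^[n] (FreeMonoid.of 0)).length := by
  rw [eq_wordPrefix_iff]
  intro i hi
  have hi' := lt_length_fibMorphism_iterate i
  have h1 : (FreeMonoid.toList (fibMorphism^[i] (FreeMonoid.of 0)))[i]? = some (fibWord i) :=
    List.getElem?_eq_getElem hi'
  rw [← h1]
  rcases le_total i n with h | h
  · obtain ⟨y, hy⟩ := fibMorphism_iterate_prefix h
    rw [hy, FreeMonoid.toList_mul, List.getElem?_append_left hi']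
  · obtain ⟨y, hy⟩ := fibMorphism_iterate_prefix h
    rw [hy, FreeMonoid.toList_mul, List.getElem?_append_left hi]

theorem exists_iterate_eq_wordPrefix_mul (n : ℕ) :
    ∃ y, fibMorphism^[n] (FreeMonoid.of 0) = wordPrefix fibWord n * y := by
  have h := lt_length_fibMorphism_iterate n
  obtain ⟨d, hd⟩ := Nat.exists_eq_add_of_le h.le
  have h2 := fibMorphism_iterate_eq_wordPrefix n
  change (fibMorphism^[n] (FreeMonoid.of 0)).length = _ at hd
  rw [hd, wordPrefix_add] at h2
  exact ⟨_, h2⟩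

theorem fibMorphism_wordPrefix (n : ℕ) :
    fibMorphism (wordPrefix fibWord n) =
      wordPrefix fibWord (fibMorphism (wordPrefix fibWord n)).length := by
  obtain ⟨y, hy⟩ := exists_iterate_eq_wordPrefix_mul n
  have h := fibMorphism_iterate_eq_wordPrefix (n + 1)
  rw [Function.iterate_succ_apply', hy, map_mul] at h
  exact eq_wordPrefix_of_mul h

theorem iterate_fibMorphism_wordPrefix (k n : ℕ) :
    fibMorphism^[k] (wordPrefix fibWord n) =
      wordPrefix fibWord (fibMorphism^[k] (wordPrefix fibWord n)).length := by
  induction k with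
  | zero => simp
  | succ k ih =>
    rw [Function.iterate_succ_apply', ih]
    exact fibMorphism_wordPrefix _

theorem length_le_length_iterate (k : ℕ) (x : FreeMonoid (Fin 2)) :
    x.length ≤ (fibMorphism^[k] x).length := by
  induction k with
  | zero => rfl
  | succ k ih =>
    rw [Function.iterate_succ_apply']
    exact ih.trans (length_le_fibMorphism _)

/-- φ^k maps a prefix of f to a prefix at least as long. This permits passing to a nonerasing
morphism. -/
theorem IsInfiniteImage.of_comp_iterate {β : Type*} {h g : FreeMonoid (Fin 2) →* FreeMonoid β}
    {u : ℕ → β} {k : ℕ} (hg : ∀ x, g x = h (fibMorphism^[k] x))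
    (hu : IsInfiniteImage g fibWord u) : IsInfiniteImage h fibWord u := by
  constructor
  · intro n
    have h1 := hu.image_prefix n
    rw [hg, iterate_fibMorphism_wordPrefix] at h1
    have h2 : n ≤ (fibMorphism^[k] (wordPrefix fibWord n)).length := by
      simpa using length_le_length_iterate k (wordPrefix fibWord n)
    obtain ⟨d, hd⟩ := Nat.exists_eq_add_of_le h2
    rw [hd, wordPrefix_add, map_mul] at h1
    exact eq_wordPrefix_of_mul h1
  · intro N
    obtain ⟨n, hn⟩ := hu.unbounded N
    rw [hg, iterate_fibMorphism_wordPrefix] at hn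
    exact ⟨_, hn⟩

theorem length_le_length_map {α β : Type*} {h : FreeMonoid α →* FreeMonoid β}
    (hh : ∀ a, 1 ≤ (h (FreeMonoid.of a)).length) (x : FreeMonoid α) :
    x.length ≤ (h x).length := by
  induction x using FreeMonoid.inductionOn' with
  | one => simp
  | of_mul a x ih =>
    rw [map_mul, FreeMonoid.length_mul, FreeMonoid.length_mul]
    exact Nat.add_le_add (by simpa using hh a) ih

theorem exists_isInfiniteImage {α β : Type*} {h : FreeMonoid α →* FreeMonoid β}
    (hh : ∀ a, 1 ≤ (h (FreeMonoid.of a)).length) (w : ℕ → α) :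
    ∃ u : ℕ → β, IsInfiniteImage h w u := by
  have hlen (n : ℕ) : n ≤ (FreeMonoid.toList (h (wordPrefix w n))).length := by
    have := length_le_length_map hh (wordPrefix w n)
    rwa [length_wordPrefix] at this
  refine ⟨fun n => (FreeMonoid.toList (h (wordPrefix w (n + 1))))[n]'(hlen (n + 1)), ?_, ?_⟩
  · intro n
    rw [eq_wordPrefix_iff]
    intro i hi
    rw [← List.getElem?_eq_getElem]
    rcases le_total n (i + 1) with hn | hn
    · obtain ⟨d, hd⟩ := Nat.exists_eq_add_of_le hn
      rw [hd, wordPrefix_add, map_mul, FreeMonoid.toList_mul, List.getElem?_append_left hi]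
    · obtain ⟨d, hd⟩ := Nat.exists_eq_add_of_le hn
      rw [hd, wordPrefix_add, map_mul, FreeMonoid.toList_mul,
        List.getElem?_append_left (hlen (i + 1))]
  · exact fun N => ⟨N, hlen N⟩

/-! ### Values of digit words. -/

/-- The pair of the values of the digit words `x` and `x0` in the Fibonacci numeration system,
for an arbitrary binary word `x`. -/
def fibValue (x : List (Fin 2)) : ℕ × ℕ :=
  x.foldl (fun p d => (p.2 + d, p.1 + p.2 + 2 * d)) (0, 0)

theorem fibValue_append_singleton (x : List (Fin 2)) (d : Fin 2) :
    fibValue (x ++ [d]) = ((fibValue x).2 + d, (fibValue x).1 + (fibValue x).2 + 2 * d) := by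
  simp [fibValue]

theorem fibValue_append (x y : List (Fin 2)) :
    ((fibValue (x ++ y)).1 : ℤ) = Nat.fib (y.length + 1) * (fibValue x).1 +
        Nat.fib y.length * ((fibValue x).2 - (fibValue x).1) + (fibValue y).1 ∧
      ((fibValue (x ++ y)).2 : ℤ) = Nat.fib (y.length + 2) * (fibValue x).1 +
        Nat.fib (y.length + 1) * ((fibValue x).2 - (fibValue x).1) + (fibValue y).2 := by
  induction y using List.reverseRecOn with
  | nil => simp [fibValue]
  | append_singleton y d ih =>
    obtain ⟨h1, h2⟩ := ih
    rw [← List.append_assoc, fibValue_append_singleton, fibValue_append_singleton]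
    simp only [List.length_append, List.length_singleton]
    push_cast
    rw [h1, h2, Nat.fib_add_two (n := y.length + 1), Nat.fib_add_two (n := y.length)]
    push_cast
    constructor <;> ring

theorem fibValue_le (x : List (Fin 2)) : (fibValue x).1 ≤ (fibValue x).2 := by
  induction x using List.reverseRecOn with
  | nil => simp [fibValue]
  | append_singleton x d ih => rw [fibValue_append_singleton]; dsimp only; omega

/-- Equality holds for the words 1⋯1; adjacent ones are allowed here. -/
theorem fibValue_lt (x : List (Fin 2)) :
    (fibValue x).1 + 2 ≤ Nat.fib (x.length + 3) ∧ (fibValue x).2 + 3 ≤ Nat.fib (x.length + 4) := by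
  induction x using List.reverseRecOn with
  | nil => simp [fibValue, Nat.fib]
  | append_singleton x d ih =>
    rw [fibValue_append_singleton]
    simp only [List.length_append, List.length_singleton]
    have h1 : Nat.fib (x.length + 1 + 4) = Nat.fib (x.length + 3) + Nat.fib (x.length + 4) :=
      Nat.fib_add_two
    have h2 : x.length + 1 + 3 = x.length + 4 := by ring
    rw [h2, h1]
    have := d.isLt
    omega

/-- Appending a digit d multiplies the error by the conjugate ψ ∈ (-1, 0) and adds (1 + ψ)d, so the
bound 1 is preserved. -/
theorem abs_fibValue_sub_le (x : List (Fin 2)) :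
    |((fibValue x).2 : ℝ) - Real.goldenRatio * (fibValue x).1| ≤ 1 := by
  induction x using List.reverseRecOn with
  | nil => simp [fibValue]
  | append_singleton x d ih =>
    rw [fibValue_append_singleton]
    have h1 := Real.goldenRatio_mul_goldenConj
    have h2 := Real.goldenRatio_add_goldenConj
    have h3 := Real.goldenConj_neg
    have h4 := Real.neg_one_lt_goldenConj
    have hd : ((d : ℕ) : ℝ) ≤ 1 := by exact_mod_cast (by omega : (d : ℕ) ≤ 1)
    have hd0 : (0 : ℝ) ≤ ((d : ℕ) : ℝ) := by positivity
    push_cast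
    have key : ((fibValue x).1 : ℝ) + (fibValue x).2 + 2 * (d : ℕ) -
        Real.goldenRatio * ((fibValue x).2 + (d : ℕ)) =
        Real.goldenConj * ((fibValue x).2 - Real.goldenRatio * (fibValue x).1) +
          (1 + Real.goldenConj) * (d : ℕ) := by
      linear_combination (-(fibValue x).2 - (d : ℕ) : ℝ) * h2 + (fibValue x).1 * h1
    rw [key]
    calc _ ≤ |Real.goldenConj * ((fibValue x).2 - Real.goldenRatio * (fibValue x).1)| +
          |(1 + Real.goldenConj) * (d : ℕ)| := abs_add_le _ _
      _ ≤ -Real.goldenConj * 1 + (1 + Real.goldenConj) * 1 := by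
        rw [abs_mul, abs_of_neg h3, abs_of_nonneg (mul_nonneg (by linarith) hd0)]
        gcongr <;> linarith
      _ = 1 := by ring

theorem fibValue_cons (d : Fin 2) (x : List (Fin 2)) :
    (fibValue (d :: x)).1 = d * Nat.fib (x.length + 2) + (fibValue x).1 := by
  have h := (fibValue_append [d] x).1
  have h1 : fibValue [d] = ((d : ℕ), 2 * (d : ℕ)) := by simp [fibValue]
  rw [h1, List.singleton_append] at h
  rw [Nat.fib_add_two]
  push_cast at h
  zify
  rw [h]
  ring

theorem fibValue_map_reverse_range (e : ℕ → Fin 2) (k : ℕ) :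
    (fibValue ((List.range k).reverse.map e)).1 =
      ∑ i ∈ Finset.range k, (e i : ℕ) * Nat.fib (i + 2) := by
  induction k with
  | zero => simp [fibValue]
  | succ k ih =>
    rw [List.range_succ, List.reverse_append, List.reverse_singleton, List.singleton_append,
      List.map_cons, fibValue_cons, ih, Finset.sum_range_succ, add_comm]
    simp

theorem pairwise_zeckendorf (n : ℕ) :
    (n.zeckendorf ++ [0]).Pairwise (fun a b => b + 2 ≤ a) := by
  have : IsTrans ℕ (fun a b => b + 2 ≤ a) := ⟨fun a b c h1 h2 => by omega⟩
  exact List.isChain_iff_pairwise.1 n.isZeckendorfRep_zeckendorf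

theorem fibValue_fibRep (n : ℕ) : (fibValue (fibRep n)).1 = n := by
  have hp := List.pairwise_append.1 (pairwise_zeckendorf n)
  have hnd : n.zeckendorf.Nodup := hp.1.imp fun h => by omega
  have h2 : ∀ a ∈ n.zeckendorf, 2 ≤ a := fun a ha => by simpa using hp.2.2 a ha 0 (by simp)
  have hle : ∀ a ∈ n.zeckendorf, a ≤ n.greatestFib := fun a ha => by
    rw [Nat.le_greatestFib]
    calc Nat.fib a ≤ (n.zeckendorf.map Nat.fib).sum :=
          List.single_le_sum (by simp) _ (List.mem_map_of_mem ha)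
      _ = n := n.sum_zeckendorf_fib
  rw [fibRep, fibValue_map_reverse_range]
  conv_rhs => rw [← n.sum_zeckendorf_fib, ← List.sum_toFinset _ hnd]
  have h3 : ∀ i, (((if i + 2 ∈ n.zeckendorf then 1 else 0 : Fin 2) : ℕ)) * Nat.fib (i + 2) =
      if i + 2 ∈ n.zeckendorf then Nat.fib (i + 2) else 0 := fun i => by split_ifs <;> simp
  simp only [h3]
  rw [← Finset.sum_filter]
  refine Finset.sum_bij (fun i _ => i + 2) ?_ ?_ ?_ ?_
  · intro i hi
    simpa using (Finset.mem_filter.1 hi).2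
  · intro i _ j _ hij
    simpa using hij
  · intro a ha
    rw [List.mem_toFinset] at ha
    have := h2 a ha
    have := hle a ha
    refine ⟨a - 2, ?_, by omega⟩
    rw [Finset.mem_filter, Finset.mem_range, Nat.sub_add_cancel (h2 a ha)]
    exact ⟨by omega, ha⟩
  · intro i _
    rfl

/-! ### Matching digit values with lengths of images. -/

theorem exists_le_and_lt_add {P : ℕ → ℕ} {L : ℕ} (h0 : P 0 = 0)
    (hs : ∀ n, P (n + 1) ≤ P n + L) (hge : ∀ n, n ≤ P n) (m : ℕ) :
    ∃ j, P j ≤ m ∧ m < P j + L := by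
  have hex : ∃ j, m < P j := ⟨m + 1, hge (m + 1)⟩
  obtain ⟨j, hj⟩ : ∃ j, Nat.find hex = j + 1 := by
    refine Nat.exists_eq_succ_of_ne_zero fun h => ?_
    have := Nat.find_spec hex
    rw [h, h0] at this
    omega
  refine ⟨j, not_lt.1 (Nat.find_min hex (by omega)), ?_⟩
  have := Nat.find_spec hex
  rw [hj] at this
  exact this.trans_le (hs j)

theorem lt_length_fibMorphism_wordPrefix (n : ℕ) :
    n + 1 < (fibMorphism (wordPrefix fibWord (n + 1))).length := by
  induction n with
  | zero => simp [wordPrefix, fibWord, fibMorphism, FreeMonoid.length_mul]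
  | succ n ih =>
    rw [wordPrefix_succ, map_mul, FreeMonoid.length_mul]
    have := length_le_fibMorphism (FreeMonoid.of (fibWord (n + 1)))
    rw [FreeMonoid.length_of] at this
    omega

theorem exists_wordPrefix_eq_fibMorphism_mul (n : ℕ) :
    ∃ m, (m < n ∨ n = 0) ∧ (wordPrefix fibWord n = fibMorphism (wordPrefix fibWord m) ∨
      ∃ a, wordPrefix fibWord n = fibMorphism (wordPrefix fibWord m) * FreeMonoid.of a) := by
  obtain ⟨j, hj1, hj2⟩ := exists_le_and_lt_add
    (P := fun n => (fibMorphism (wordPrefix fibWord n)).length) (L := 2) (by simp [wordPrefix])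
    (fun n => by
      simp only [wordPrefix_succ, map_mul, FreeMonoid.length_mul]
      generalize fibWord n = a
      fin_cases a <;> simp [fibMorphism, FreeMonoid.length_mul])
    (fun n => by simpa using length_le_fibMorphism (wordPrefix fibWord n)) n
  refine ⟨j, ?_, ?_⟩
  · rcases j with _ | j
    · omega
    · have := lt_length_fibMorphism_wordPrefix j
      omega
  · rw [fibMorphism_wordPrefix j]
    obtain h | h : n = (fibMorphism (wordPrefix fibWord j)).length ∨
        n = (fibMorphism (wordPrefix fibWord j)).length + 1 := by omega
    · left
      rw [← h]
    · right
      exact ⟨_, by rw [h, wordPrefix_succ]⟩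

/-- The error E is additive, and φ multiplies it by the conjugate ψ. A nonempty prefix of f is φ of
a shorter prefix followed by at most one letter, so the errors stay bounded by the fixed point of C
↦ |ψ|C + e. -/
theorem exists_abs_length_sub_le {β : Type*} (h : FreeMonoid (Fin 2) →* FreeMonoid β) :
    ∃ C : ℝ, ∀ n, |((h (fibMorphism (wordPrefix fibWord n))).length : ℝ) -
      Real.goldenRatio * (h (wordPrefix fibWord n)).length| ≤ C := by
  let E : FreeMonoid (Fin 2) → ℝ := fun x =>
    ((h (fibMorphism x)).length : ℝ) - Real.goldenRatio * (h x).length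
  change ∃ C : ℝ, ∀ n, |E (wordPrefix fibWord n)| ≤ C
  have h1 := Real.goldenRatio_mul_goldenConj
  have h2 := Real.goldenRatio_add_goldenConj
  have h3 := Real.goldenConj_neg
  have h4 := Real.neg_one_lt_goldenConj
  have hmul (x y) : E (x * y) = E x + E y := by
    simp only [E, map_mul, FreeMonoid.length_mul]
    push_cast
    ring
  have hfib (x) : E (fibMorphism x) = Real.goldenConj * E x := by
    simp only [E, length_iterate_fibMorphism_add_two]
    push_cast
    linear_combination (-((h (fibMorphism x)).length : ℝ)) * h2 + ((h x).length : ℝ) * h1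
  obtain ⟨e, he⟩ : ∃ e, ∀ a, |E (FreeMonoid.of a)| ≤ e :=
    ⟨∑ a, |E (FreeMonoid.of a)|, fun a => Finset.single_le_sum
      (f := fun a => |E (FreeMonoid.of a)|) (fun _ _ => abs_nonneg _) (Finset.mem_univ a)⟩
  have he0 : 0 ≤ e := (abs_nonneg _).trans (he 0)
  obtain ⟨C, hC0, hC⟩ : ∃ C, 0 ≤ C ∧ -Real.goldenConj * C + e = C := by
    refine ⟨e / (1 + Real.goldenConj), div_nonneg he0 (by linarith), ?_⟩
    have := div_mul_cancel₀ e (by linarith : 1 + Real.goldenConj ≠ 0)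
    linarith
  refine ⟨C, fun n => ?_⟩
  induction n using Nat.strong_induction_on with
  | _ n ih =>
    obtain ⟨m, hm, hn⟩ := exists_wordPrefix_eq_fibMorphism_mul n
    rcases hm with hm | rfl
    · have h5 : |E (fibMorphism (wordPrefix fibWord m))| ≤ -Real.goldenConj * C := by
        rw [hfib, abs_mul, abs_of_neg h3]
        exact mul_le_mul_of_nonneg_left (ih m hm) (by linarith)
      rcases hn with hn | ⟨a, hn⟩
      · rw [hn]
        linarith
      · rw [hn, hmul]
        exact (abs_add_le _ _).trans ((add_le_add h5 (he a)).trans hC.le)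
    · simpa [E, wordPrefix] using hC0

/-- For every digit word `x` there is a prefix of the Fibonacci word whose images under `h` and
`h ∘ φ` have lengths that differ from the values of `x` and `x0` by bounded amounts. -/
theorem exists_wordPrefix_near_fibValue {β : Type*} {h : FreeMonoid (Fin 2) →* FreeMonoid β}
    (hh : ∀ a, 1 ≤ (h (FreeMonoid.of a)).length) :
    ∃ K : ℕ, ∀ x, ∃ j A B, A ≤ K ∧ B ≤ K ∧
      (fibValue x).1 = (h (wordPrefix fibWord j)).length + A ∧
      (fibValue x).2 = (h (fibMorphism (wordPrefix fibWord j))).length + A + B := by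
  obtain ⟨C, hC⟩ := exists_abs_length_sub_le h
  have hφ1 := Real.one_lt_goldenRatio
  have hφ2 := Real.goldenRatio_lt_two
  -- Aiming D below V(x) makes A ≥ D, which outweighs both errors and forces B ≥ 0.
  obtain ⟨D, hD⟩ := exists_nat_ge ((1 + C) / (Real.goldenRatio - 1))
  rw [div_le_iff₀ (by linarith)] at hD
  obtain ⟨C', hC'⟩ := exists_nat_ge (1 + C)
  let L := (h (FreeMonoid.of 0)).length + (h (FreeMonoid.of 1)).length
  have hge (n : ℕ) : n ≤ (h (wordPrefix fibWord n)).length := by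
    simpa using length_le_length_map hh (wordPrefix fibWord n)
  refine ⟨D + L + C', fun x => ?_⟩
  obtain ⟨j, hj1, hj2⟩ := exists_le_and_lt_add
    (P := fun n => (h (wordPrefix fibWord n)).length) (L := L) (by simp [wordPrefix])
    (fun n => by
      simp only [wordPrefix_succ, map_mul, FreeMonoid.length_mul, L]
      generalize fibWord n = a
      fin_cases a <;> simp) hge ((fibValue x).1 - D)
  obtain ⟨A, hA⟩ := Nat.exists_eq_add_of_le (hj1.trans (Nat.sub_le _ _))
  have hAK : A ≤ D + L := by omega
  have h1 := abs_le.1 (abs_fibValue_sub_le x)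
  have h2 := abs_le.1 (hC j)
  have hAr : ((fibValue x).1 : ℝ) = (h (wordPrefix fibWord j)).length + A := by
    exact_mod_cast hA
  rw [hAr] at h1
  have hB : (h (fibMorphism (wordPrefix fibWord j))).length + A ≤ (fibValue x).2 := by
    by_cases hD' : D ≤ (fibValue x).1
    · have h3 : (D : ℝ) ≤ A := by exact_mod_cast (by omega : D ≤ A)
      have h4 : (D : ℝ) * (Real.goldenRatio - 1) ≤ A * (Real.goldenRatio - 1) :=
        mul_le_mul_of_nonneg_right h3 (by linarith)
      have : ((h (fibMorphism (wordPrefix fibWord j))).length : ℝ) + A ≤ (fibValue x).2 := by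
        linarith
      exact_mod_cast this
    -- Here the truncated subtraction gives 0, so p is empty.
    · have h3 := hge j
      obtain rfl : j = 0 := by omega
      have := fibValue_le x
      simp [wordPrefix] at hA ⊢
      omega
  obtain ⟨B, hB⟩ := Nat.exists_eq_add_of_le hB
  refine ⟨j, A, B, by omega, ?_, hA, hB⟩
  have hBr : ((fibValue x).2 : ℝ) =
      (h (fibMorphism (wordPrefix fibWord j))).length + A + B := by exact_mod_cast hB
  have h3 : (A : ℝ) * (Real.goldenRatio - 1) ≤ A * 1 :=
    mul_le_mul_of_nonneg_left (by linarith) (by positivity)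
  have h4 : (A : ℝ) ≤ D + L := by exact_mod_cast hAK
  have : (B : ℝ) ≤ D + L + C' := by linarith
  exact_mod_cast this

/-! ### The automaton. -/

/-- A form of the Myhill–Nerode theorem for automata with output. -/
theorem exists_dfao_of_finite {α : Type} {Δ T : Type*} {v : List α → Δ} {S : Set T}
    (hS : S.Finite) {τ : List α → T} (hτ : ∀ x, τ x ∈ S)
    (H : ∀ x x', τ x = τ x' → ∀ y, v (x ++ y) = v (x' ++ y)) :
    ∃ M : DFAO α Δ, ∀ x, v x = M.eval x := by
  let s : Setoid (List α) :=
    { r := fun x x' => ∀ y, v (x ++ y) = v (x' ++ y)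
      iseqv := ⟨fun _ _ => rfl, fun h y => (h y).symm, fun h h' y => (h y).trans (h' y)⟩ }
  have hfin : Finite (Quotient s) := by
    have := hS.to_subtype
    refine Finite.of_injective (fun q : Quotient s => (⟨τ q.out, hτ _⟩ : S)) fun q q' hq => ?_
    rw [← q.out_eq, ← q'.out_eq]
    exact Quotient.sound (H _ _ (congrArg Subtype.val hq))
  let M : DFAO α Δ :=
    { State := Quotient s
      finite_state := hfin
      start := Quotient.mk s []
      step := fun q a => Quotient.map (fun x => x ++ [a])
        (fun x x' hx y => by simpa using hx ([a] ++ y)) q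
      output := Quotient.lift v fun x x' hx => by simpa using hx [] }
  refine ⟨M, fun x => ?_⟩
  have hfold : x.foldl M.step M.start = Quotient.mk s x := by
    induction x using List.reverseRecOn with
    | nil => rfl
    | append_singleton x a ih => rw [List.foldl_append, ih]; rfl
  rw [DFAO.eval, hfold]
  rfl

theorem fib_succ_mul_length_le (k : ℕ) (x : FreeMonoid (Fin 2)) :
    Nat.fib (k + 1) * x.length ≤ (fibMorphism^[k] x).length := by
  have h := length_iterate_fibMorphism (MonoidHom.id _) x k
  simp only [MonoidHom.id_apply] at h
  have h1 : (x.length : ℤ) ≤ (fibMorphism x).length := by exact_mod_cast length_le_fibMorphism x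
  zify
  rw [h]
  exact le_add_of_nonneg_right (mul_nonneg (by positivity) (by linarith))

theorem isFibonacciAutomatic_of_isInfiniteImage {Δ : Type*}
    {h : FreeMonoid (Fin 2) →* FreeMonoid Δ} (hh : ∀ a, 1 ≤ (h (FreeMonoid.of a)).length)
    {u : ℕ → Δ} (hu : IsInfiniteImage h fibWord u) : IsFibonacciAutomatic u := by
  obtain ⟨K, hK⟩ := exists_wordPrefix_near_fibValue hh
  choose j A B hA hB h1 h2 using hK
  -- The offset is below F_{k+1} K + F_k K + F_{k+3} ≤ (2K + 3) F_{k+1}, a lower bound for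
  -- |h(φ^k(w))|.
  let w : List (Fin 2) → FreeMonoid (Fin 2) := fun x =>
    wordPrefix (fun i => fibWord (j x + i)) (2 * K + 3)
  have key (x y : List (Fin 2)) : some (u (fibValue (x ++ y)).1) =
      (FreeMonoid.toList (h (fibMorphism^[y.length] (w x))))[
        Nat.fib (y.length + 1) * A x + Nat.fib y.length * B x + (fibValue y).1]? := by
    set k := y.length with hk
    set t := Nat.fib (k + 1) * A x + Nat.fib k * B x + (fibValue y).1 with ht
    set p := wordPrefix fibWord (j x) with hp
    have hN : (fibValue (x ++ y)).1 = (h (fibMorphism^[k] p)).length + t := by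
      zify
      rw [(fibValue_append x y).1, length_iterate_fibMorphism, ht, h1, h2]
      push_cast
      ring
    have hlt : t < (h (fibMorphism^[k] (w x))).length := by
      have h3 := fib_succ_mul_length_le k (w x)
      rw [length_wordPrefix] at h3
      have h4 := (fibValue_lt y).1
      have h5 : Nat.fib (k + 3) = Nat.fib (k + 1) + (Nat.fib k + Nat.fib (k + 1)) := by
        rw [Nat.fib_add_two (n := k + 1), Nat.fib_add_two (n := k)]
      have h6 : Nat.fib k ≤ Nat.fib (k + 1) := Nat.fib_le_fib_succ
      have h7 : Nat.fib (k + 1) * A x ≤ Nat.fib (k + 1) * K := Nat.mul_le_mul_left _ (hA x)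
      have h8 : Nat.fib k * B x ≤ Nat.fib (k + 1) * K := Nat.mul_le_mul h6 (hB x)
      have h9 := length_le_length_map hh (fibMorphism^[k] (w x))
      rw [← hk] at h4
      linarith
    have hpre : wordPrefix fibWord (j x + (2 * K + 3)) = p * w x := wordPrefix_add _ _ _
    have h3 := hu.image_prefix (fibMorphism^[k] (p * w x)).length
    rw [← hpre, ← iterate_fibMorphism_wordPrefix, hpre, iterate_fibMorphism_mul, map_mul,
      eq_wordPrefix_iff] at h3
    rw [hN, ← h3 _ (by rw [FreeMonoid.length_mul]; omega), FreeMonoid.toList_mul]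
    have h4 := List.getElem?_append_right (l₁ := FreeMonoid.toList (h (fibMorphism^[k] p)))
      (l₂ := FreeMonoid.toList (h (fibMorphism^[k] (w x)))) (Nat.le_add_right _ t)
    rwa [Nat.add_sub_cancel_left] at h4
  obtain ⟨M, hM⟩ := exists_dfao_of_finite (v := fun x => u (fibValue x).1)
    (S := Set.Iic K ×ˢ Set.Iic K ×ˢ {l : List (Fin 2) | l.length = 2 * K + 3})
    (τ := fun x => (A x, B x, FreeMonoid.toList (w x)))
    ((Set.finite_Iic K).prod ((Set.finite_Iic K).prod (List.finite_length_eq _ _)))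
    (fun x => ⟨hA x, hB x, length_wordPrefix _ _⟩)
    (fun x x' hx y => by
      simp only [Prod.mk.injEq, EmbeddingLike.apply_eq_iff_eq] at hx
      apply Option.some_injective
      rw [key, key, hx.1, hx.2.1, hx.2.2])
  exact ⟨M, fun n => by rw [← hM, fibValue_fibRep]⟩

theorem mainTheorem11 {Δ : Type*} (h : FreeMonoid (Fin 2) →* FreeMonoid Δ)
    (h01 : h (FreeMonoid.of 0 * FreeMonoid.of 1) ≠ 1) :
    ∃ u : ℕ → Δ, IsInfiniteImage h fibWord u ∧ IsFibonacciAutomatic u := by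
  -- φ²(0) = 010 and φ²(1) = 01 both contain 01.
  let g := h.comp (fibMorphism.comp fibMorphism)
  have hg : ∀ a, 1 ≤ (g (FreeMonoid.of a)).length := by
    have h1 : 1 ≤ (h (FreeMonoid.of 0 * FreeMonoid.of 1)).length :=
      Nat.one_le_iff_ne_zero.2 fun h0 => h01 (FreeMonoid.length_eq_zero.1 h0)
    rw [map_mul, FreeMonoid.length_mul] at h1
    intro a
    fin_cases a <;> simp [g, fibMorphism, FreeMonoid.length_mul] <;> omega
  obtain ⟨u, hu⟩ := exists_isInfiniteImage hg fibWord
  exact ⟨u, hu.of_comp_iterate (k := 2) fun _ => rfl,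
    isFibonacciAutomatic_of_isInfiniteImage hg hu⟩
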